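/- Let $n\ge 1$ and let $\lambda=(\lambda_1\ge\cdots\ge\lambda_\ell>0)$ be a Young diagram with $\ell(\lambda)=\ell<n$ and $\gcd(n,|\lambda|)=1$. Let $SST_n(\lambda)$ be the set of semistandard tableaux of shape $\lambda$ with entries in $\{1,\dots,n\}$, with its standard $U_q(\mathfrak{sl}_n)$-crystal structure: a tableau $T$ is identified with its Far-Eastern reading word (columns from right to left, each read from top to bottom), regarded as an element of a tensor power of the crystal $1\to 2\to\cdots\to n$ of the vector representation, and the crystal operators $\tilde e_i,\tilde f_i$ ($1\le i\le n-1$) are given by Kashiwara's tensor product rule, namely $\tilde f_i(b_1\otimes b_2)=\tilde f_ib_1\otimes b_2$ if $\varphi_i(b_1)>\varepsilon_i(b_2)$ and $b_1\otimes\tilde f_ib_2$ otherwise, and $\tilde e_i(b_1\otimes b_2)=\tilde e_ib_1\otimes b_2$ if $\varphi_i(b_1)\ge\varepsilon_i(b_2)$ and $b_1\otimes\tilde e_ib_2$ otherwise. Let $c_k(T)$ be the number of entries of $T$ equal to $k$, so that $\langle h_i,\mathrm{wt}(T)\rangle=c_i(T)-c_{i+1}(T)$. For $1\le i\le n-1$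 let $\tilde s_i$ be the bijection of $SST_n(\lambda)$ given by $$\tilde s_i(T)=\tilde f_i^{\,\langle h_i,\mathrm{wt}(T)\rangle}T\ \text{ if }\langle h_i,\mathrm{wt}(T)\rangle\ge 0,\qquad \tilde s_i(T)=\tilde e_i^{\,-\langle h_i,\mathrm{wt}(T)\rangle}T\ \text{ otherwise,}$$ let $\mathsf c=\tilde s_1\tilde s_2\cdots\tilde s_{n-1}$ (composition of maps), and let $C=\langle\mathsf c\rangle$ be the cyclic group of bijections of $SST_n(\lambda)$ generated by $\mathsf c$. Let $s_\lambda(x_1,\dots,x_n)=\sum_{T\in SST_n(\lambda)}\prod_{k=1}^n x_k^{c_k(T)}$ be the Schur polynomial, and $\kappa(\lambda)=\sum_{i\ge 1}(i-1)\lambda_i$. Then $C$ has order $n$, and 1. every orbit of $C$ on $SST_n(\lambda)$ is free, i.e. every $T\in SST_n(\lambda)$ has trivial stabilizer in $C$; 2. $f(q)=q^{-\kappa(\lambda)}s_\lambda(1,q,\dots,q^{n-1})$ is a polynomial in $q$ with nonnegative integer coefficients, and the triple $(SST_n(\lambda),C,f(q))$ exhibits the cyclic sieving phenomenon: for every $g\in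 C$ and every primitive $o(g)$-th root of unity $\omega\in\mathbb C$, where $o(g)$ is the order of $g$, $$\#\{T\in SST_n(\lambda): gT=T\}=f(\omega).$$ -/

import Mathlib

/-! ### Tensor products of the vector representation crystal

The crystal of the vector representation of `sl_n` has the letters `1, …, n` as its elements, with
`f̃_a : a ↦ a + 1` and `ẽ_a : a + 1 ↦ a` the only nonzero arrows of colour `a`.  A word is an element
of a tensor power of this crystal.  A word is given here by a list `L` of positions
and a function `t` assigning a letter to each position.  The functions below are the tensor product
rule (in Kashiwara's convention)
* `ε(b₁ ⊗ b₂) = ε(b₁) + max(0, ε(b₂) - φ(b₁))`, `φ(b₁ ⊗ b₂) = φ(b₂) + max(0, φ(b₁) - ε(b₂))`,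
* `f̃(b₁ ⊗ b₂) = f̃ b₁ ⊗ b₂` if `φ(b₁) > ε(b₂)`, and `b₁ ⊗ f̃ b₂` otherwise,
* `ẽ(b₁ ⊗ b₂) = ẽ b₁ ⊗ b₂` if `φ(b₁) ≥ ε(b₂)`, and `b₁ ⊗ ẽ b₂` otherwise. -/
namespace WordCrystal

variable {α : Type*}

/-- `φ_a` of a single letter. -/
def letterPhi (a x : ℕ) : ℕ := if x = a then 1 else 0

/-- `ε_a` of a single letter. -/
def letterEps (a x : ℕ) : ℕ := if x = a + 1 then 1 else 0

/-- `ε_a` of a word. The subtraction is truncated: it is `max(0, -)`. -/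
def eps (a : ℕ) (t : α → ℕ) : List α → ℕ
  | [] => 0
  | b :: L => letterEps a (t b) + (eps a t L - letterPhi a (t b))

/-- `φ_a` of a word. The subtraction is truncated: it is `max(0, -)`. -/
def phi (a : ℕ) (t : α → ℕ) : List α → ℕ
  | [] => 0
  | b :: L => phi a t L + (letterPhi a (t b) - eps a t L)

/-- The position of the word at which `f̃_a` changes the letter `a` to `a + 1`
(`none` if `f̃_a` sends the word to `0`). -/
def fPos (a : ℕ) (t : α → ℕ) : List α → Option α
  | [] => none
  | b :: L => if eps a t L < letterPhi a (t b) then some b else fPos a t L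

/-- The position of the word at which `ẽ_a` changes the letter `a + 1` to `a`
(`none` if `ẽ_a` sends the word to `0`). -/
def ePos (a : ℕ) (t : α → ℕ) : List α → Option α
  | [] => none
  | b :: L =>
    if eps a t L ≤ letterPhi a (t b) then (if t b = a + 1 then some b else none) else ePos a t L

theorem letter_cases (a x : ℕ) :
    (x = a ∧ letterPhi a x = 1 ∧ letterEps a x = 0) ∨
    (x = a + 1 ∧ letterPhi a x = 0 ∧ letterEps a x = 1) ∨
    (x ≠ a ∧ x ≠ a + 1 ∧ letterPhi a x = 0 ∧ letterEps a x = 0) := by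
  unfold letterPhi letterEps
  split_ifs <;> omega

theorem eps_congr {a : ℕ} {t u : α → ℕ} {L : List α} (h : ∀ x ∈ L, t x = u x) :
    eps a t L = eps a u L := by
  induction L with
  | nil => rfl
  | cons b L ih =>
    simp only [eps, h b (by simp), ih fun x hx => h x (by simp [hx])]

theorem phi_sub_eps (a : ℕ) (t : α → ℕ) (L : List α) :
    (phi a t L : ℤ) - eps a t L =
      (L.countP (fun x => t x = a) : ℤ) - L.countP (fun x => t x = a + 1) := by
  induction L with
  | nil => simp [phi, eps]
  | cons b L ih =>
    simp only [phi, eps, List.countP_cons, decide_eq_true_eq]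
    rcases letter_cases a (t b) with ⟨h, h1, h2⟩ | ⟨h, h1, h2⟩ | ⟨h, h0, h1, h2⟩
    · rw [h1, h2, if_pos h, if_neg (by omega)]; omega
    · rw [h1, h2, if_pos h, if_neg (by omega)]; omega
    · rw [h1, h2, if_neg h, if_neg h0]; omega

theorem fPos_eq_none {a : ℕ} {t : α → ℕ} {L : List α} (h : fPos a t L = none) :
    phi a t L = 0 := by
  induction L with
  | nil => rfl
  | cons b L ih =>
    simp only [fPos] at h
    split_ifs at h with h1
    simp only [phi, ih h]; omega

theorem ePos_eq_none {a : ℕ} {t : α → ℕ} {L : List α} (h : ePos a t L = none) :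
    eps a t L = 0 := by
  induction L with
  | nil => rfl
  | cons b L ih =>
    simp only [ePos] at h
    simp only [eps]
    rcases letter_cases a (t b) with ⟨h0, h1, h2⟩ | ⟨h0, h1, h2⟩ | ⟨h0, h3, h1, h2⟩ <;>
    split_ifs at h with h4 <;> first | omega | (have := ih h; omega)

theorem fPos_spec {a : ℕ} {t : α → ℕ} {L : List α} {b : α} (h : fPos a t L = some b) :
    t b = a ∧ ∃ P S, L = P ++ b :: S ∧ eps a t S = 0 ∧
      ∀ P₁ x P₂, P = P₁ ++ x :: P₂ → t x = a → eps a t (P₂ ++ b :: S) ≠ 0 := by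
  induction L with
  | nil => simp [fPos] at h
  | cons c L ih =>
    simp only [fPos] at h
    split_ifs at h with h1
    · obtain rfl : c = b := by simpa using h
      have hc := letter_cases a (t c)
      refine ⟨by omega, [], L, rfl, by omega, ?_⟩
      intro P₁ x P₂ hP
      simp at hP
    · obtain ⟨hb, P, S, rfl, hS, hP⟩ := ih h
      refine ⟨hb, c :: P, S, rfl, hS, ?_⟩
      intro P₁ x P₂ hE hx
      cases P₁ with
      | nil =>
        simp only [List.nil_append, List.cons.injEq] at hE
        obtain ⟨rfl, rfl⟩ := hE
        have hc := letter_cases a (t c)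
        omega
      | cons y P₁ =>
        simp only [List.cons_append, List.cons.injEq] at hE
        exact hP P₁ x P₂ hE.2 hx

theorem ePos_spec {a : ℕ} {t : α → ℕ} {L : List α} {b : α} (h : ePos a t L = some b) :
    t b = a + 1 ∧ ∃ P S, L = P ++ b :: S ∧ eps a t S = 0 ∧
      ∀ P₁ x P₂, P = P₁ ++ x :: P₂ → t x = a → eps a t (P₂ ++ b :: S) ≠ 1 := by
  induction L with
  | nil => simp [ePos] at h
  | cons c L ih =>
    simp only [ePos] at h
    have hc := letter_cases a (t c)
    split_ifs at h with h1 h2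
    · obtain rfl : c = b := by simpa using h
      refine ⟨by omega, [], L, rfl, by omega, ?_⟩
      intro P₁ x P₂ hP
      simp at hP
    · obtain ⟨hb, P, S, rfl, hS, hP⟩ := ih h
      refine ⟨hb, c :: P, S, rfl, hS, ?_⟩
      intro P₁ x P₂ hE hx
      cases P₁ with
      | nil =>
        simp only [List.nil_append, List.cons.injEq] at hE
        obtain ⟨rfl, rfl⟩ := hE
        omega
      | cons y P₁ =>
        simp only [List.cons_append, List.cons.injEq] at hE
        exact hP P₁ x P₂ hE.2 hx

theorem eps_eq_zero_append {a : ℕ} {t : α → ℕ} {M L : List α} (hM : ∀ x ∈ M, t x ≠ a + 1)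
    (hL : eps a t L = 0) : eps a t (M ++ L) = 0 := by
  induction M with
  | nil => exact hL
  | cons b M ih =>
    have h := ih fun x hx => hM x (by simp [hx])
    have hb := letter_cases a (t b)
    have := hM b (by simp)
    simp only [List.cons_append, eps, h]
    omega

theorem eps_pos_append {a : ℕ} {t : α → ℕ} {M L : List α} (hM : ∀ x ∈ M, t x ≠ a)
    (hL : 0 < eps a t L) : 0 < eps a t (M ++ L) := by
  induction M with
  | nil => exact hL
  | cons b M ih =>
    have h := ih fun x hx => hM x (by simp [hx])
    have hb := letter_cases a (t b)
    have := hM b (by simp)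
    simp only [List.cons_append, eps]
    omega

variable [DecidableEq α]

theorem eps_update_of_notMem {a v : ℕ} {t : α → ℕ} {L : List α} {b : α} (h : b ∉ L) :
    eps a (Function.update t b v) L = eps a t L :=
  eps_congr fun x hx => Function.update_of_ne (by rintro rfl; exact h hx) _ _

theorem fPos_update {a : ℕ} {t : α → ℕ} {L : List α} {b : α} (hL : L.Nodup)
    (h : fPos a t L = some b) :
    eps a (Function.update t b (a + 1)) L = eps a t L + 1 ∧
      ePos a (Function.update t b (a + 1)) L = some b := by
  induction L with
  | nil => simp [fPos] at h
  | cons c L ih =>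
    rw [List.nodup_cons] at hL
    simp only [fPos] at h
    have hc := letter_cases a (t c)
    split_ifs at h with h1
    · obtain rfl : c = b := by simpa using h
      have hc' := letter_cases a (a + 1)
      simp only [eps, ePos, eps_update_of_notMem hL.1, Function.update_self]
      refine ⟨by omega, ?_⟩
      rw [if_pos (by omega), if_pos trivial]
    · obtain ⟨i1, i2⟩ := ih hL.2 h
      have hbL : b ∈ L := by
        obtain ⟨-, P, S, rfl, -⟩ := fPos_spec h
        simp
      have hcb : c ≠ b := by rintro rfl; exact hL.1 hbL
      simp only [eps, ePos, Function.update_of_ne hcb, i1]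
      refine ⟨by omega, ?_⟩
      rw [if_neg (by omega), i2]

theorem ePos_update {a : ℕ} {t : α → ℕ} {L : List α} {b : α} (hL : L.Nodup)
    (h : ePos a t L = some b) :
    eps a (Function.update t b a) L + 1 = eps a t L ∧
      fPos a (Function.update t b a) L = some b := by
  induction L with
  | nil => simp [ePos] at h
  | cons c L ih =>
    rw [List.nodup_cons] at hL
    simp only [ePos] at h
    have hc := letter_cases a (t c)
    split_ifs at h with h1 h2
    · obtain rfl : c = b := by simpa using h
      have hc' := letter_cases a a
      simp only [eps, fPos, eps_update_of_notMem hL.1, Function.update_self]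
      refine ⟨by omega, ?_⟩
      rw [if_pos (by omega)]
    · obtain ⟨i1, i2⟩ := ih hL.2 h
      have hbL : b ∈ L := by
        obtain ⟨-, P, S, rfl, -⟩ := ePos_spec h
        simp
      have hcb : c ≠ b := by rintro rfl; exact hL.1 hbL
      simp only [eps, fPos, Function.update_of_ne hcb]
      refine ⟨by omega, ?_⟩
      rw [if_neg (by omega), i2]

end WordCrystal

/-! ### Semistandard tableaux with bounded entries -/

/-- `SST n μ` is the set of semistandard tableaux of shape `μ` with entries in `{1, …, n}`. -/
def SST (n : ℕ) (μ : YoungDiagram) : Type :=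
  {T : SemistandardYoungTableau μ // ∀ i j, (i, j) ∈ μ → 1 ≤ T i j ∧ T i j ≤ n}

namespace SST

variable {n : ℕ} {μ : YoungDiagram}

/-- The entry of a tableau at a box (and `0` outside the shape). -/
def entry (T : SST n μ) (b : ℕ × ℕ) : ℕ := T.1 b.1 b.2

theorem entry_injective : Function.Injective (entry : SST n μ → ℕ × ℕ → ℕ) := by
  intro T U h
  refine Subtype.ext (SemistandardYoungTableau.ext fun i j => ?_)
  exact congrFun h (i, j)

instance : Finite (SST n μ) := by
  refine Finite.of_injective
    (fun (T : SST n μ) (b : μ.cells) => (⟨T.entry b.1, ?_⟩ : Fin (n + 1))) ?_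
  · have := (T.2 b.1.1 b.1.2 (by simp)).2
    exact Nat.lt_succ_of_le this
  · intro T U h
    apply entry_injective
    funext b
    by_cases hb : b ∈ μ
    · have := congrFun h ⟨b, by simpa using hb⟩
      simpa using this
    · exact (T.1.zeros hb).trans (U.1.zeros hb).symm

noncomputable instance : Fintype (SST n μ) := Fintype.ofFinite _

/-- The number `c_k` of occurrences of `k` in `T`; the content of `T` is `(c_1, …, c_n)`. -/
def content (T : SST n μ) (k : ℕ) : ℕ := (μ.cells.filter fun b => T.entry b = k).card

end SST

/-- The Schur polynomial `s_μ(x_1, …, x_n) = ∑_T x^T`, the sum being over `SST n μ`.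
The variable `x_k` is `X (k - 1)`. -/
noncomputable def schurPoly (n : ℕ) (μ : YoungDiagram) : MvPolynomial (Fin n) ℕ :=
  ∑ T : SST n μ, ∏ k : Fin n, MvPolynomial.X k ^ T.content (k + 1)

/-- The principal specialization `s_μ(1, q, …, q^{n-1})`, as a polynomial in `q`. -/
noncomputable def schurPrincipal (n : ℕ) (μ : YoungDiagram) : Polynomial ℕ :=
  MvPolynomial.aeval (fun k : Fin n => (Polynomial.X : Polynomial ℕ) ^ (k : ℕ)) (schurPoly n μ)

namespace YoungDiagram

/-- The length `ℓ(μ)`: the number of nonempty rows. -/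
def length (μ : YoungDiagram) : ℕ := μ.rowLens.length

/-- The statistic `κ(μ) = ∑_{i ≥ 1} (i - 1) μ_i` (rows are indexed from `0` here). -/
def kappa (μ : YoungDiagram) : ℕ := ∑ i ∈ Finset.range μ.length, i * μ.rowLen i

/-- The boxes of `μ` in the order of the Far-Eastern reading: columns from right to left, each
column from top to bottom. -/
def readingBoxes (μ : YoungDiagram) : List (ℕ × ℕ) :=
  (List.range (μ.rowLen 0)).reverse.flatMap fun j => (List.range (μ.colLen j)).map fun i => (i, j)

theorem mem_readingBoxes {μ : YoungDiagram} {b : ℕ × ℕ} : b ∈ μ.readingBoxes ↔ b ∈ μ := by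
  obtain ⟨i, j⟩ := b
  simp only [readingBoxes, List.mem_flatMap, List.mem_reverse, List.mem_range, List.mem_map,
    Prod.mk.injEq]
  constructor
  · rintro ⟨j', -, i', hi, rfl, rfl⟩
    exact mem_iff_lt_colLen.2 hi
  · intro h
    exact ⟨j, mem_iff_lt_rowLen.1 (μ.up_left_mem (Nat.zero_le i) le_rfl h), i,
      mem_iff_lt_colLen.1 h, rfl, rfl⟩

/-- `x` is read before `y`. -/
def ReadBefore (x y : ℕ × ℕ) : Prop := y.2 < x.2 ∨ x.2 = y.2 ∧ x.1 < y.1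

theorem pairwise_readingBoxes (μ : YoungDiagram) : μ.readingBoxes.Pairwise ReadBefore := by
  rw [readingBoxes, List.pairwise_flatMap]
  constructor
  · intro j _
    rw [List.pairwise_map]
    exact List.pairwise_lt_range.imp fun h => Or.inr ⟨rfl, h⟩
  · rw [List.pairwise_reverse]
    refine List.pairwise_lt_range.imp fun {j k} h x hx y hy => ?_
    simp only [List.mem_map] at hx hy
    obtain ⟨_, _, rfl⟩ := hx
    obtain ⟨_, _, rfl⟩ := hy
    exact Or.inl h

theorem nodup_readingBoxes (μ : YoungDiagram) : μ.readingBoxes.Nodup :=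
  (pairwise_readingBoxes μ).imp fun {x y} h => by
    rintro rfl
    unfold ReadBefore at h
    omega

theorem readingBoxes_split {μ : YoungDiagram} {P S : List (ℕ × ℕ)} {b : ℕ × ℕ}
    (h : μ.readingBoxes = P ++ b :: S) :
    (∀ x ∈ P, ReadBefore x b) ∧ (∀ x ∈ S, ReadBefore b x) ∧
      (∀ x ∈ μ, ReadBefore x b → x ∈ P) ∧ (∀ x ∈ μ, ReadBefore b x → x ∈ S) := by
  have hp := pairwise_readingBoxes μ
  rw [h, List.pairwise_append, List.pairwise_cons] at hp
  obtain ⟨-, ⟨h1, -⟩, h2⟩ := hp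
  have hP : ∀ x ∈ P, ReadBefore x b := fun x hx => h2 x hx b (by simp)
  refine ⟨hP, h1, fun x hx hxb => ?_, fun x hx hxb => ?_⟩ <;>
  · rw [← mem_readingBoxes, h, List.mem_append, List.mem_cons] at hx
    rcases hx with hx | rfl | hx
    · have := hP x hx
      first | exact hx | (unfold ReadBefore at *; omega)
    · unfold ReadBefore at hxb; omega
    · have := h1 x hx
      first | exact hx | (unfold ReadBefore at *; omega)

end YoungDiagram

/-! ### The crystal structure on semistandard tableaux

A tableau is identified with its Far-Eastern reading word in a tensor power of the
crystal of the vector representation. -/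
namespace SST

open WordCrystal YoungDiagram

variable {n : ℕ} {μ : YoungDiagram}

theorem entry_row (T : SST n μ) {i j k : ℕ} (h : j ≤ k) (hk : (i, k) ∈ μ) :
    T.entry (i, j) ≤ T.entry (i, k) := T.1.row_weak_of_le h hk

theorem entry_col (T : SST n μ) {i k j : ℕ} (h : i < k) (hk : (k, j) ∈ μ) :
    T.entry (i, j) < T.entry (k, j) := T.1.col_strict h hk

/-- `T.Settable b v`: replacing the entry of the box `b` of `T` by `v` gives a tableau in
`SST n μ`. -/
structure Settable (T : SST n μ) (b : ℕ × ℕ) (v : ℕ) : Prop where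
  mem : b ∈ μ
  bounds : 1 ≤ v ∧ v ≤ n
  right : (b.1, b.2 + 1) ∈ μ → v ≤ T.entry (b.1, b.2 + 1)
  below : (b.1 + 1, b.2) ∈ μ → v < T.entry (b.1 + 1, b.2)
  left : ∀ j, b.2 = j + 1 → T.entry (b.1, j) ≤ v
  above : ∀ i, b.1 = i + 1 → T.entry (i, b.2) < v

/-- The tableau obtained from `T` by replacing the entry of the box `b` by `v`. -/
def set (T : SST n μ) (b : ℕ × ℕ) (v : ℕ) (h : T.Settable b v) : SST n μ :=
  ⟨{ entry := fun i j => Function.update T.entry b v (i, j)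
     row_weak' := by
      intro i j k hjk hk
      obtain ⟨r, c⟩ := b
      have h0 := T.entry_row hjk.le hk
      by_cases hb : (i, k) = (r, c)
      · obtain ⟨rfl, rfl⟩ := Prod.mk.inj hb
        rw [Function.update_self, Function.update_of_ne (by simp; omega)]
        obtain ⟨m, rfl⟩ : ∃ m, k = m + 1 := ⟨k - 1, by omega⟩
        exact (T.entry_row (by omega) (μ.up_left_mem le_rfl (Nat.le_succ m) hk)).trans
          (h.left m rfl)
      · rw [Function.update_of_ne hb]
        by_cases hc : (i, j) = (r, c)
        · obtain ⟨rfl, rfl⟩ := Prod.mk.inj hc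
          rw [Function.update_self]
          exact (h.right (μ.up_left_mem le_rfl hjk hk)).trans (T.entry_row hjk hk)
        · rwa [Function.update_of_ne hc]
     col_strict' := by
      intro i k j hik hk
      obtain ⟨r, c⟩ := b
      have h0 := T.entry_col hik hk
      by_cases hb : (k, j) = (r, c)
      · obtain ⟨rfl, rfl⟩ := Prod.mk.inj hb
        rw [Function.update_self, Function.update_of_ne (by simp; omega)]
        obtain ⟨m, rfl⟩ : ∃ m, k = m + 1 := ⟨k - 1, by omega⟩
        exact (T.1.col_weak (by omega : i ≤ m)
          (μ.up_left_mem (Nat.le_succ m) le_rfl hk)).trans_lt (h.above m rfl)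
      · rw [Function.update_of_ne hb]
        by_cases hc : (i, j) = (r, c)
        · obtain ⟨rfl, rfl⟩ := Prod.mk.inj hc
          rw [Function.update_self]
          exact (h.below (μ.up_left_mem hik le_rfl hk)).trans_le
            (T.1.col_weak (by exact hik) hk)
        · rwa [Function.update_of_ne hc]
     zeros' := by
      intro i j hij
      rw [Function.update_of_ne (by rintro rfl; exact hij h.mem)]
      exact T.1.zeros hij },
   by
    intro i j hij
    change 1 ≤ Function.update T.entry b v (i, j) ∧ Function.update T.entry b v (i, j) ≤ n
    by_cases hb : (i, j) = b
    · subst hb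
      rw [Function.update_self]
      exact h.bounds
    · rw [Function.update_of_ne hb]
      exact T.2 i j hij⟩

theorem entry_set (T : SST n μ) (b : ℕ × ℕ) (v : ℕ) (h : T.Settable b v) :
    (T.set b v h).entry = Function.update T.entry b v := rfl

theorem settable_fPos (T : SST n μ) {a : ℕ} (ha : a + 1 ≤ n) {b : ℕ × ℕ}
    (h : fPos a T.entry μ.readingBoxes = some b) : T.Settable b (a + 1) := by
  obtain ⟨hb, P, S, hE, hS, hP⟩ := fPos_spec h
  obtain ⟨hP1, hS1, hP2, hS2⟩ := readingBoxes_split hE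
  have hmem : b ∈ μ := by rw [← mem_readingBoxes, hE]; simp
  obtain ⟨r, c⟩ := b
  have hbelow : (r + 1, c) ∈ μ → T.entry (r + 1, c) ≠ a + 1 := by
    intro hm he
    obtain ⟨M, S', rfl⟩ := List.append_of_mem (hS2 _ hm (Or.inr ⟨rfl, Nat.lt_succ_self r⟩))
    have hE2 : μ.readingBoxes = (P ++ (r, c) :: M) ++ (r + 1, c) :: S' := by simp [hE]
    have hlt : 0 < eps a T.entry (M ++ (r + 1, c) :: S') := by
      apply eps_pos_append
      · intro x hx
        have h1 := hS1 x (by simp [hx])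
        have h2 := (readingBoxes_split hE2).1 x (by simp [hx])
        unfold ReadBefore at h1 h2
        simp only at h1 h2
        omega
      · simp [eps, letterEps, he]
    omega
  refine ⟨hmem, ⟨by omega, ha⟩, ?_, ?_, ?_, ?_⟩
  · intro hm
    have h0 := T.entry_row (Nat.le_succ c) hm
    by_contra hlt
    have he : T.entry (r, c + 1) = a := by
      simp only [Nat.succ_eq_add_one] at hlt h0 hb
      omega
    obtain ⟨P₁, M, rfl⟩ := List.append_of_mem (hP2 _ hm (Or.inl (Nat.lt_succ_self c)))
    refine hP P₁ _ M rfl he (eps_eq_zero_append ?_ ?_)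
    · intro x hx hxa
      have hE2 : μ.readingBoxes = P₁ ++ (r, c + 1) :: (M ++ (r, c) :: S) := by simp [hE]
      have h1 := hP1 x (by simp [hx])
      have h2 := (readingBoxes_split hE2).2.1 x (by simp [hx])
      have hxm : x ∈ μ := by rw [← mem_readingBoxes, hE]; simp [hx]
      obtain ⟨i, j⟩ := x
      unfold ReadBefore at h1 h2
      simp only at h1 h2
      by_cases hj : j = c
      · subst hj
        have := T.entry_col (show i < r by omega) hmem
        omega
      · obtain rfl : j = c + 1 := by omega
        have hri : r < i := by omega
        have hm' : (r + 1, c + 1) ∈ μ := μ.up_left_mem hri le_rfl hxm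
        have hm2 : (r + 1, c) ∈ μ := μ.up_left_mem le_rfl (Nat.le_succ c) hm'
        have e1 := T.entry_row (Nat.le_succ c) hm'
        have e2 : T.entry (r + 1, c + 1) ≤ T.entry (i, c + 1) :=
          T.1.col_weak (by exact hri) hxm
        have e3 := T.entry_col (Nat.lt_succ_self r) hm2
        have := hbelow hm2
        simp only [Nat.succ_eq_add_one] at e1 e3
        omega
    · have hc := letter_cases a (T.entry (r, c))
      simp only [eps, hS]
      omega
  · intro hm
    have h0 := T.entry_col (Nat.lt_succ_self r) hm
    have := hbelow hm
    simp only [Nat.succ_eq_add_one] at h0 ⊢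
    omega
  · rintro j rfl
    have h0 := T.entry_row (Nat.le_succ j) hmem
    simp only [Nat.succ_eq_add_one] at h0 hb ⊢
    omega
  · rintro i rfl
    have h0 := T.entry_col (Nat.lt_succ_self i) hmem
    simp only [Nat.succ_eq_add_one] at h0 hb ⊢
    omega

theorem settable_ePos (T : SST n μ) {a : ℕ} (ha : 1 ≤ a) {b : ℕ × ℕ}
    (h : ePos a T.entry μ.readingBoxes = some b) : T.Settable b a := by
  obtain ⟨hb, P, S, hE, hS, hP⟩ := ePos_spec h
  obtain ⟨hP1, hS1, hP2, hS2⟩ := readingBoxes_split hE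
  have hmem : b ∈ μ := by rw [← mem_readingBoxes, hE]; simp
  obtain ⟨r, c⟩ := b
  have hbn : T.entry (r, c) ≤ n := (T.2 r c hmem).2
  have habove : ∀ i, r = i + 1 → T.entry (i, c) ≠ a := by
    rintro i rfl he
    have hm : (i, c) ∈ μ := μ.up_left_mem (Nat.le_succ i) le_rfl hmem
    obtain ⟨P₁, M, rfl⟩ := List.append_of_mem (hP2 _ hm (Or.inr ⟨rfl, Nat.lt_succ_self i⟩))
    have hE2 : μ.readingBoxes = P₁ ++ (i, c) :: (M ++ (i + 1, c) :: S) := by simp [hE]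
    have hM : M = [] := by
      rw [List.eq_nil_iff_forall_not_mem]
      intro x hx
      have h1 := hP1 x (by simp [hx])
      have h2 := (readingBoxes_split hE2).2.1 x (by simp [hx])
      unfold ReadBefore at h1 h2
      simp only at h1 h2
      omega
    subst hM
    refine hP P₁ _ [] rfl he ?_
    simp [eps, letterEps, hb, hS]
  refine ⟨hmem, ⟨ha, by omega⟩, ?_, ?_, ?_, ?_⟩
  · intro hm
    have h0 := T.entry_row (Nat.le_succ c) hm
    simp only [Nat.succ_eq_add_one] at h0 ⊢
    omega
  · intro hm
    have h0 := T.entry_col (Nat.lt_succ_self r) hm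
    simp only [Nat.succ_eq_add_one] at h0 ⊢
    omega
  · rintro j hj
    simp only at hj
    subst hj
    have h0 := T.entry_row (Nat.le_succ j) hmem
    by_contra hlt
    have he : T.entry (r, j) = a + 1 := by simp only [Nat.succ_eq_add_one] at hlt h0; omega
    have hm : (r, j) ∈ μ := μ.up_left_mem le_rfl (Nat.le_succ j) hmem
    obtain ⟨M, S', rfl⟩ := List.append_of_mem (hS2 _ hm (Or.inl (Nat.lt_succ_self j)))
    have hE2 : μ.readingBoxes = (P ++ (r, j + 1) :: M) ++ (r, j) :: S' := by simp [hE]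
    have hlt : 0 < eps a T.entry (M ++ (r, j) :: S') := by
      apply eps_pos_append
      · intro x hx hxa
        have h1 := hS1 x (by simp [hx])
        have h2 := (readingBoxes_split hE2).1 x (by simp [hx])
        have hxm : x ∈ μ := by rw [← mem_readingBoxes, hE]; simp [hx]
        obtain ⟨i, k⟩ := x
        unfold ReadBefore at h1 h2
        simp only at h1 h2
        by_cases hk : k = j
        · subst hk
          obtain ⟨m, rfl⟩ : ∃ m, r = m + 1 := ⟨r - 1, by omega⟩
          have hm1 : (m, k + 1) ∈ μ := μ.up_left_mem (Nat.le_succ m) le_rfl hmem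
          have hm0 : (m, k) ∈ μ := μ.up_left_mem le_rfl (Nat.le_succ k) hm1
          have e1 : T.entry (i, k) ≤ T.entry (m, k) := T.1.col_weak (by omega) hm0
          have e2 := T.entry_row (Nat.le_succ k) hm1
          have e3 := T.entry_col (Nat.lt_succ_self m) hmem
          have := habove m rfl
          simp only [Nat.succ_eq_add_one] at e2 e3
          omega
        · obtain rfl : k = j + 1 := by omega
          have := T.entry_col (show r < i by omega) hxm
          omega
      · simp [eps, letterEps, he]
    omega
  · rintro i hi
    simp only at hi
    subst hi
    have h0 := T.entry_col (Nat.lt_succ_self i) hmem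
    have := habove i rfl
    simp only [Nat.succ_eq_add_one] at h0 ⊢
    omega

/-- The crystal operator `f̃_i`; `none` stands for `0`. The index `i : Fin (n - 1)` corresponds to
`i + 1` in `I = {1, …, n - 1}`. -/
def crystalF (i : Fin (n - 1)) (T : SST n μ) : Option (SST n μ) :=
  (fPos (i + 1) T.entry μ.readingBoxes).pmap (fun b hb => T.set b (i + 2) hb)
    fun _ hb => T.settable_fPos (by omega) hb

/-- The crystal operator `ẽ_i`; `none` stands for `0`. The index `i : Fin (n - 1)` corresponds to
`i + 1` in `I = {1, …, n - 1}`. -/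
def crystalE (i : Fin (n - 1)) (T : SST n μ) : Option (SST n μ) :=
  (ePos (i + 1) T.entry μ.readingBoxes).pmap (fun b hb => T.set b (i + 1) hb)
    fun _ hb => T.settable_ePos (by omega) hb

/-- `⟨h_i, wt(T)⟩ = c_i - c_{i+1}`, where `wt(T) = ∑ c_k ε_k` is given by the content of `T`. -/
def pairing (i : Fin (n - 1)) (T : SST n μ) : ℤ := T.content (i + 1) - T.content (i + 2)

/-- `ε_i(T)`. -/
def crystalEps (i : Fin (n - 1)) (T : SST n μ) : ℕ := eps (i + 1) T.entry μ.readingBoxes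

/-- `φ_i(T)`. -/
def crystalPhi (i : Fin (n - 1)) (T : SST n μ) : ℕ := phi (i + 1) T.entry μ.readingBoxes

theorem content_eq_countP (T : SST n μ) (k : ℕ) :
    T.content k = μ.readingBoxes.countP fun b => T.entry b = k := by
  have h : μ.cells = μ.readingBoxes.toFinset := by
    ext b
    simp [mem_readingBoxes]
  rw [content, h, List.countP_eq_length_filter,
    ← List.toFinset_card_of_nodup ((nodup_readingBoxes μ).filter _), List.toFinset_filter]
  simp

theorem phi_sub_eps_eq (i : Fin (n - 1)) (T : SST n μ) :
    (T.crystalPhi i : ℤ) - T.crystalEps i = T.pairing i := by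
  rw [pairing, content_eq_countP, content_eq_countP]
  exact phi_sub_eps _ _ _

theorem content_set (T : SST n μ) {b : ℕ × ℕ} {v : ℕ} (h : T.Settable b v) (k : ℕ) :
    ((T.set b v h).content k : ℤ) =
      T.content k + (if k = v then 1 else 0) - (if k = T.entry b then 1 else 0) := by
  have key : ∀ t : ℕ × ℕ → ℕ, ((μ.cells.filter fun b => t b = k).card : ℤ) =
      (∑ x ∈ μ.cells.erase b, if t x = k then 1 else 0) + if t b = k then 1 else 0 := by
    intro t
    rw [Finset.card_filter, ← Finset.sum_erase_add _ _ (show b ∈ μ.cells from h.mem)]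
    push_cast
    rfl
  rw [content, content, entry_set, key, key, Function.update_self,
    Finset.sum_congr rfl (g := fun x => if T.entry x = k then (1 : ℤ) else 0) (fun x hx => by
      rw [Function.update_of_ne (Finset.ne_of_mem_erase hx)])]
  simp only [eq_comm (b := k)]
  split_ifs <;> omega

theorem crystalF_eq_some {i : Fin (n - 1)} {T U : SST n μ} (h : crystalF i T = some U) :
    crystalE i U = some T ∧ U.crystalEps i = T.crystalEps i + 1 ∧
      U.pairing i = T.pairing i - 2 := by
  simp only [crystalF, Option.pmap_eq_some_iff] at h
  obtain ⟨b, hset, hb, rfl⟩ := h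
  have hb' := (fPos_spec hb).1
  obtain ⟨h1, h2⟩ := fPos_update (nodup_readingBoxes μ) hb
  refine ⟨?_, h1, ?_⟩
  · simp only [crystalE, Option.pmap_eq_some_iff]
    refine ⟨b, ?_, h2, ?_⟩
    · exact settable_ePos _ (by omega) h2
    · apply entry_injective
      rw [entry_set, entry_set, Function.update_idem, ← hb', Function.update_eq_self]
  · rw [pairing, pairing, content_set, content_set, hb']
    simp
    ring

theorem crystalE_eq_some {i : Fin (n - 1)} {T U : SST n μ} (h : crystalE i T = some U) :
    crystalF i U = some T ∧ U.crystalEps i + 1 = T.crystalEps i ∧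
      U.pairing i = T.pairing i + 2 := by
  simp only [crystalE, Option.pmap_eq_some_iff] at h
  obtain ⟨b, hset, hb, rfl⟩ := h
  have hb' := (ePos_spec hb).1
  obtain ⟨h1, h2⟩ := ePos_update (nodup_readingBoxes μ) hb
  refine ⟨?_, h1, ?_⟩
  · simp only [crystalF, Option.pmap_eq_some_iff]
    refine ⟨b, ?_, h2, ?_⟩
    · exact settable_fPos _ (by omega) h2
    · apply entry_injective
      rw [entry_set, entry_set, Function.update_idem]
      have h3 := Function.update_eq_self b T.entry
      rw [hb'] at h3
      exact h3.symm
  · rw [pairing, pairing, content_set, content_set, hb']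
    simp
    ring

/-- The power `g^k` of a partially defined operator. -/
def partialPow {α : Type*} (g : α → Option α) : ℕ → α → Option α
  | 0, x => some x
  | k + 1, x => (g x).bind (partialPow g k)

theorem partialPow_add_one {α : Type*} (g : α → Option α) (k : ℕ) (x : α) :
    partialPow g (k + 1) x = (partialPow g k x).bind g := by
  induction k generalizing x with
  | zero => cases h : g x <;> simp [partialPow, h]
  | succ k ih =>
    rw [partialPow]
    cases h : g x with
    | none => simp [partialPow, h]
    | some y => simp [partialPow, h, ← ih y]

theorem partialPow_crystalF (i : Fin (n - 1)) (k : ℕ) (T : SST n μ)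
    (hk : k ≤ T.crystalPhi i) :
    ∃ U, partialPow (crystalF i) k T = some U ∧ partialPow (crystalE i) k U = some T ∧
      U.pairing i = T.pairing i - 2 * k := by
  induction k generalizing T with
  | zero => exact ⟨T, rfl, rfl, by simp⟩
  | succ k ih =>
    cases hf : crystalF i T with
    | none =>
      have h0 : fPos (i + 1) T.entry μ.readingBoxes = none := by
        simpa [crystalF, Option.pmap_eq_none_iff] using hf
      have := fPos_eq_none h0
      unfold crystalPhi at hk
      omega
    | some V =>
      obtain ⟨h1, h2, h3⟩ := crystalF_eq_some hf
      have e1 := T.phi_sub_eps_eq i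
      have e2 := V.phi_sub_eps_eq i
      obtain ⟨U, hU, hU', hp⟩ := ih V (by omega)
      refine ⟨U, ?_, ?_, ?_⟩
      · simp [partialPow, hf, hU]
      · rw [partialPow_add_one, hU']
        exact h1
      · push_cast
        omega

theorem partialPow_crystalE (i : Fin (n - 1)) (k : ℕ) (T : SST n μ)
    (hk : k ≤ T.crystalEps i) :
    ∃ U, partialPow (crystalE i) k T = some U ∧ partialPow (crystalF i) k U = some T ∧
      U.pairing i = T.pairing i + 2 * k := by
  induction k generalizing T with
  | zero => exact ⟨T, rfl, rfl, by simp⟩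
  | succ k ih =>
    cases hf : crystalE i T with
    | none =>
      have h0 : ePos (i + 1) T.entry μ.readingBoxes = none := by
        simpa [crystalE, Option.pmap_eq_none_iff] using hf
      have := ePos_eq_none h0
      unfold crystalEps at hk
      omega
    | some V =>
      obtain ⟨h1, h2, h3⟩ := crystalE_eq_some hf
      obtain ⟨U, hU, hU', hp⟩ := ih V (by omega)
      refine ⟨U, ?_, ?_, ?_⟩
      · simp [partialPow, hf, hU]
      · rw [partialPow_add_one, hU']
        exact h1
      · push_cast
        omega

theorem isSome_partialPow_crystalF (i : Fin (n - 1)) (T : SST n μ) :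
    (partialPow (crystalF i) (T.pairing i).toNat T).isSome := by
  have := T.phi_sub_eps_eq i
  obtain ⟨U, hU, -⟩ := T.partialPow_crystalF i (T.pairing i).toNat (by omega)
  simp [hU]

theorem isSome_partialPow_crystalE (i : Fin (n - 1)) (T : SST n μ) :
    (partialPow (crystalE i) (-T.pairing i).toNat T).isSome := by
  have := T.phi_sub_eps_eq i
  obtain ⟨U, hU, -⟩ := T.partialPow_crystalE i (-T.pairing i).toNat (by omega)
  simp [hU]

/-- The map `s̃_i`: it sends `T` to `f̃_i^{⟨h_i, wt T⟩} T` if `⟨h_i, wt T⟩ ≥ 0`, and to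
`ẽ_i^{-⟨h_i, wt T⟩} T` otherwise. -/
def reflectionFun (i : Fin (n - 1)) (T : SST n μ) : SST n μ :=
  if 0 ≤ T.pairing i then
    (partialPow (crystalF i) (T.pairing i).toNat T).get (T.isSome_partialPow_crystalF i)
  else
    (partialPow (crystalE i) (-T.pairing i).toNat T).get (T.isSome_partialPow_crystalE i)

theorem reflectionFun_involutive (i : Fin (n - 1)) :
    Function.Involutive (reflectionFun i : SST n μ → SST n μ) := by
  intro T
  have hT := T.phi_sub_eps_eq i
  by_cases h : 0 ≤ T.pairing i
  · obtain ⟨U, hU, hU', hp⟩ := T.partialPow_crystalF i (T.pairing i).toNat (by omega)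
    have e : reflectionFun i T = U := by
      rw [reflectionFun, if_pos h]
      simp [hU]
    rw [e, reflectionFun]
    by_cases h0 : T.pairing i = 0
    · have hUT : U = T := by simpa [h0, partialPow, eq_comm] using hU
      subst hUT
      rw [if_pos h]
      simp [h0, partialPow]
    · rw [if_neg (by omega)]
      have : (-U.pairing i).toNat = (T.pairing i).toNat := by omega
      simp [this, hU']
  · obtain ⟨U, hU, hU', hp⟩ := T.partialPow_crystalE i (-T.pairing i).toNat (by omega)
    have e : reflectionFun i T = U := by
      rw [reflectionFun, if_neg h]
      simp [hU]
    rw [e, reflectionFun, if_pos (by omega)]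
    have : (U.pairing i).toNat = (-T.pairing i).toNat := by omega
    simp [this, hU']

/-- The bijection `s̃_i` of `SST n μ`, through which the simple reflection `s_i` acts. -/
def reflection (n : ℕ) (μ : YoungDiagram) (i : Fin (n - 1)) : Equiv.Perm (SST n μ) :=
  (reflectionFun_involutive i).toPerm

/-- The crystal Coxeter element `s̃_1 s̃_2 ⋯ s̃_{n-1}`, as a bijection of `SST n μ`. -/
def coxeter (n : ℕ) (μ : YoungDiagram) : Equiv.Perm (SST n μ) :=
  (List.ofFn (reflection n μ)).prod

end SST

/-- `(X, C, f)` exhibits the cyclic sieving phenomenon: `C` is a finite cyclic group acting on the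
finite set `X`, and for all `g ∈ C` the number of fixed points of `g` is the value of `f` at a
primitive root of unity of order `o(g)`. The condition `IsPrimitiveRoot ω (orderOf g)` says that the
multiplicative order of `ω` is the order of `g`. -/
def CyclicSieving (X : Type*) [Finite X] (C : Type*) [Group C] [Finite C] [IsCyclic C]
    [MulAction C X] (f : Polynomial ℕ) : Prop :=
  ∀ (g : C) (ω : ℂ), IsPrimitiveRoot ω (orderOf g) →
    (Nat.card (MulAction.fixedBy X g) : ℂ) = Polynomial.aeval ω f

/-! The point is that the maps `s̃_i` satisfy the relations of the symmetric group, so that `𝖼` is the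
image of an `n`-cycle and `𝖼 ^ n = 1`. The rest is bookkeeping of contents.

*Braid relations.* Row insertion of the letters `a, a + 1, a + 2` of a word, from right to left,
attaches to it a Gelfand–Tsetlin pattern and a recording word (`WordCrystal.record`), which
together determine the word (`record_inj`). The recording word is constant along the arrows of
colours `a` and `a + 1` (`record_update_left`, `record_update_right`), and the pattern is a function of
the content, of `ε_a` and of the number of times each row is recorded. Since `ε_{a+1}` is a piecewise
linear function of the pattern (`isPattern`) and a crystal reflection exchanges `ε` with `φ` of its
colour, both sides of the braid relation lead to the same pattern (`SST.reflection_braid`).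
Colours that are not adjacent are treated in the same way with `WordCrystal.record₂`.

*Order of `𝖼`.* If `c_m` is a product of `m` generators satisfying the relations of type `A_m`, then
`c_m ^ (m + 1) = c_{m-1} ^ m`, so that `c_m ^ (m + 1) = 1` (`prodRange_pow_add_one`).

*Freeness and sieving.* The map `𝖼` rotates the content `(c_1, …, c_n)`, hence raises
`∑ (k - 1) c_k` by `|μ|` modulo `n` (`SST.charge_coxeter`). As `|μ|` is prime to `n`, a power `𝖼 ^ k` with a
fixed point has `n ∣ k`. At an `n`-th root of unity `ω`, the sum `∑_T ω ^ (∑ (k - 1) c_k(T))` is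
multiplied by `ω ^ |μ|` when it is reindexed along `𝖼`, so it vanishes when `ω ≠ 1`; at `ω = 1` it counts
the tableaux. -/

/-! ### The recording word for three consecutive letters -/

namespace WordCrystal

variable {α : Type*}

/-- The row (`0`, `1` or `2`) in which the shape of a semistandard tableau in the letters
`a, a + 1, a + 2` grows when the letter `x` is row-inserted. The tableau is described by the number
`e` of letters `a + 1` in its first row, the numbers `A` and `B` of letters `≤ a + 1` in its first and
second rows, and the lengths `l₁`, `l₂` of these rows.
Any other letter is encoded as `x + 3`, so that it can be recovered. -/
def growth (e A B l₁ l₂ : ℕ) (a x : ℕ) : ℕ :=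
  if x = a then
    if 0 < e then (if B < l₂ then 2 else 1) else (if A < l₁ then 1 else 0)
  else if x = a + 1 then (if A < l₁ then 1 else 0)
  else if x = a + 2 then 0
  else x + 3

/-- The number of occurrences of the letter `k` in a word. -/
def mult (k : ℕ) (t : α → ℕ) (L : List α) : ℕ := L.countP fun x => t x = k

/-- The recording word of a word under row insertion of its letters `a, a + 1, a + 2`, read from
right to left. The insertion tableau itself is not kept: its entries are determined by the
multiplicities of the letters, by `ε_a` (the number of letters `a + 1` in its first row), and by the
row lengths, which are the numbers of `0`, `1` and `2` recorded so far. -/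
def record (a : ℕ) (t : α → ℕ) : List α → List ℕ
  | [] => []
  | b :: L =>
    growth (eps a t L) (mult a t L + eps a t L) (mult (a + 1) t L - eps a t L)
      ((record a t L).count 0) ((record a t L).count 1) a (t b) :: record a t L

theorem mult_cons (k : ℕ) (t : α → ℕ) (b : α) (L : List α) :
    mult k t (b :: L) = mult k t L + if t b = k then 1 else 0 := by
  simp [mult, List.countP_cons]

theorem triple_cases (a x : ℕ) :
    x = a ∨ x = a + 1 ∨ x = a + 2 ∨ (x ≠ a ∧ x ≠ a + 1 ∧ x ≠ a + 2) := by omega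

/-- The numbers attached to a word in the letters `a, a + 1, a + 2` are those of a Gelfand–Tsetlin
pattern with top row `l₁, l₂, l₃`, middle row `c₁ + e₁, c₂ - e₁` and bottom row `c₁`.
Here `c₁, c₂, c₃` are the multiplicities of the letters, and `e₁, e₂` are `ε_a` and `ε_{a+1}`. The last
field is the piecewise linear formula for `ε_{a+1}` in terms of the pattern; the truncated
subtraction in it is `max(0, -)`. -/
structure IsPattern (c₁ c₂ c₃ e₁ e₂ l₁ l₂ l₃ : ℕ) : Prop where
  size : c₁ + c₂ + c₃ = l₁ + l₂ + l₃
  le₁ : l₃ + e₁ ≤ c₂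
  le₂ : c₂ ≤ l₂ + e₁
  le₃ : l₂ ≤ c₁ + e₁
  le₄ : c₁ + e₁ ≤ l₁
  le₅ : c₂ ≤ c₁ + e₁
  eps_eq : e₂ + (c₁ + e₁) = l₁ + (l₂ - c₂)

/-- Row insertion preserves the interlacing inequalities, and the tensor product rule for
`ε_{a+1}` is compatible with the formula on patterns. -/
theorem isPattern (a : ℕ) (t : α → ℕ) (L : List α) :
    IsPattern (mult a t L) (mult (a + 1) t L) (mult (a + 2) t L) (eps a t L) (eps (a + 1) t L)
      ((record a t L).count 0) ((record a t L).count 1) ((record a t L).count 2) := by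
  induction L with
  | nil => constructor <;> simp [mult, eps, record]
  | cons b L ih =>
    obtain ⟨h1, h2, h3, h4, h5, h6, h7⟩ := ih
    simp only [mult_cons, eps, record, List.count_cons, growth, letterPhi, letterEps,
      beq_iff_eq]
    rcases triple_cases a (t b) with h | h | h | ⟨h, h', h''⟩
    all_goals
      simp only [if_true, if_false, *]
      constructor <;> grind

/-- Row insertion is injective: the letters are recovered one by one from the recording word and
the final pattern. -/
theorem record_inj {a : ℕ} {t u : α → ℕ} {L : List α} (hR : record a t L = record a u L)
    (h₁ : mult a t L = mult a u L) (h₂ : mult (a + 1) t L = mult (a + 1) u L)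
    (he : eps a t L = eps a u L) : ∀ x ∈ L, t x = u x := by
  induction L with
  | nil => simp
  | cons b L ih =>
    obtain ⟨p1, p2, p3, p4, p5, p6, -⟩ := isPattern a t L
    obtain ⟨q1, q2, q3, q4, q5, q6, -⟩ := isPattern a u L
    simp only [record, List.cons.injEq] at hR
    obtain ⟨hg, hR⟩ := hR
    simp only [hR] at p1 p2 p3 p4 p5 hg
    simp only [growth, eps, mult_cons, letterPhi, letterEps] at hg h₁ h₂ he
    have key : t b = u b ∧ mult a t L = mult a u L ∧ mult (a + 1) t L = mult (a + 1) u L ∧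
        eps a t L = eps a u L := by
      rcases triple_cases a (t b) with h | h | h | ⟨h, h', h''⟩ <;>
      rcases triple_cases a (u b) with k | k | k | ⟨k, k', k''⟩ <;>
      simp only [if_true, if_false, *] at hg h₁ h₂ he ⊢ <;> grind
    intro x hx
    rcases List.mem_cons.1 hx with rfl | hx
    · exact key.1
    · exact ih hR key.2.1 key.2.2.1 key.2.2.2 x hx

/-- The recording word of a word under row insertion in the letters `a, a + 1` and, separately, in
the letters `c, c + 1`, from right to left. It is meant for colours `a` and `c` that are not adjacent.
The values `0, 1` (for `a`) and `2, 3` (for `c`) say whether the second or the first row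
grows; any other letter is encoded as itself plus `4`. -/
def record₂ (a c : ℕ) (t : α → ℕ) : List α → List ℕ
  | [] => []
  | b :: L =>
    (if t b = a then (if 0 < eps a t L then 0 else 1)
      else if t b = a + 1 then 1
      else if t b = c then (if 0 < eps c t L then 2 else 3)
      else if t b = c + 1 then 3
      else t b + 4) :: record₂ a c t L

theorem record₂_inj {a c : ℕ} (hac : a + 1 < c) {t u : α → ℕ} {L : List α}
    (hR : record₂ a c t L = record₂ a c u L)
    (ha : eps a t L = eps a u L) (hc : eps c t L = eps c u L) : ∀ x ∈ L, t x = u x := by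
  induction L with
  | nil => simp
  | cons b L ih =>
    simp only [record₂, List.cons.injEq] at hR
    obtain ⟨hg, hR⟩ := hR
    simp only [eps, letterPhi, letterEps] at ha hc
    have key : t b = u b ∧ eps a t L = eps a u L ∧ eps c t L = eps c u L := by
      grind (splits := 20)
    intro x hx
    rcases List.mem_cons.1 hx with rfl | hx
    · exact key.1
    · exact ih hR key.2.1 key.2.2 x hx

theorem mem_of_fPos {a : ℕ} {t : α → ℕ} {L : List α} {p : α} (h : fPos a t L = some p) :
    p ∈ L := by
  obtain ⟨-, P, S, rfl, -⟩ := fPos_spec h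
  simp

theorem record_congr {a : ℕ} {t u : α → ℕ} {L : List α} (h : ∀ x ∈ L, t x = u x) :
    record a t L = record a u L := by
  induction L with
  | nil => rfl
  | cons b L ih =>
    have h' : ∀ x ∈ L, t x = u x := fun x hx => h x (by simp [hx])
    have hm : ∀ k, mult k t L = mult k u L := fun k =>
      List.countP_congr fun x hx => by rw [h' x hx]
    simp only [record, ih h', hm, eps_congr h', h b (by simp)]

theorem record₂_congr {a c : ℕ} {t u : α → ℕ} {L : List α} (h : ∀ x ∈ L, t x = u x) :
    record₂ a c t L = record₂ a c u L := by
  induction L with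
  | nil => rfl
  | cons b L ih =>
    have h' : ∀ x ∈ L, t x = u x := fun x hx => h x (by simp [hx])
    simp only [record₂, ih h', eps_congr h', h b (by simp)]

variable [DecidableEq α]

theorem mult_update {t : α → ℕ} {L : List α} {p : α} (hL : L.Nodup) (hp : p ∈ L) (k v : ℕ) :
    mult k (Function.update t p v) L + (if t p = k then 1 else 0) =
      mult k t L + if v = k then 1 else 0 := by
  induction L with
  | nil => simp at hp
  | cons b L ih =>
    rw [List.nodup_cons] at hL
    rw [mult_cons, mult_cons]
    by_cases h : p = b
    · subst h
      have : mult k (Function.update t p v) L = mult k t L :=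
        List.countP_congr fun x hx => by
          rw [Function.update_of_ne (by rintro rfl; exact hL.1 hx)]
      rw [this, Function.update_self]
      ring
    · have := ih hL.2 (by simpa [h] using hp)
      rw [Function.update_of_ne (Ne.symm h)]
      omega

/-- The recording word is invariant under `f̃_a`. -/
theorem record_update_left {a : ℕ} {t : α → ℕ} {L : List α} {p : α} (hL : L.Nodup)
    (h : fPos a t L = some p) : record a (Function.update t p (a + 1)) L = record a t L := by
  induction L with
  | nil => rfl
  | cons b L ih =>
    rw [List.nodup_cons] at hL
    simp only [fPos] at h
    split_ifs at h with h1
    · obtain rfl : b = p := by simpa using h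
      have ht : ∀ x ∈ L, Function.update t b (a + 1) x = t x := fun x hx =>
        Function.update_of_ne (by rintro rfl; exact hL.1 hx) _ _
      have hm : ∀ k, mult k (Function.update t b (a + 1)) L = mult k t L := fun k =>
        List.countP_congr fun x hx => by rw [ht x hx]
      simp only [record, record_congr ht, hm, eps_congr ht, Function.update_self]
      unfold letterPhi at h1
      congr 1
      grind [growth]
    · have hi := ih hL.2 h
      have hp := mem_of_fPos h
      have hpa := (fPos_spec h).1
      have he := (fPos_update hL.2 h).1
      have m1 := mult_update (t := t) hL.2 hp a (a + 1)
      have m2 := mult_update (t := t) hL.2 hp (a + 1) (a + 1)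
      have hbp : b ≠ p := by rintro rfl; exact hL.1 hp
      simp only [record, hi, Function.update_of_ne hbp]
      unfold letterPhi at h1
      congr 1
      grind [growth]

/-- The recording word is invariant under `f̃_{a+1}`. -/
theorem record_update_right {a : ℕ} {t : α → ℕ} {L : List α} {p : α} (hL : L.Nodup)
    (h : fPos (a + 1) t L = some p) :
    record a (Function.update t p (a + 2)) L = record a t L := by
  induction L with
  | nil => rfl
  | cons b L ih =>
    obtain ⟨p1, p2, p3, p4, p5, p6, p7⟩ := isPattern a t L
    obtain ⟨q1, q2, q3, q4, q5, q6, q7⟩ := isPattern a (Function.update t p (a + 2)) L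
    rw [List.nodup_cons] at hL
    simp only [fPos] at h
    split_ifs at h with h1
    · obtain rfl : b = p := by simpa using h
      have ht : ∀ x ∈ L, Function.update t b (a + 2) x = t x := fun x hx =>
        Function.update_of_ne (by rintro rfl; exact hL.1 hx) _ _
      have hm : ∀ k, mult k (Function.update t b (a + 2)) L = mult k t L := fun k =>
        List.countP_congr fun x hx => by rw [ht x hx]
      simp only [record, record_congr ht, hm, eps_congr ht, Function.update_self]
      unfold letterPhi at h1
      congr 1
      grind [growth]
    · have hi := ih hL.2 h
      have hp := mem_of_fPos h
      have hpa := (fPos_spec h).1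
      -- `f̃_{a+1}` raises `ε_{a+1}` by one. As the row lengths are unchanged, the formulas for
      -- `ε_{a+1}` of the two patterns determine the new value of `ε_a`.
      have he := (fPos_update hL.2 h).1
      have m1 := mult_update (t := t) hL.2 hp a (a + 2)
      have m2 := mult_update (t := t) hL.2 hp (a + 1) (a + 2)
      have m3 := mult_update (t := t) hL.2 hp (a + 2) (a + 2)
      have hbp : b ≠ p := by rintro rfl; exact hL.1 hp
      simp only [record, hi, Function.update_of_ne hbp] at *
      simp only [letterPhi] at h1
      congr 1
      rw [hpa] at m1 m2 m3
      simp at m1 m2 m3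
      simp only [show a + 1 + 1 = a + 2 from rfl] at *
      rcases triple_cases a (t b) with h | h | h | ⟨h, h', h''⟩ <;>
      simp only [growth, if_true, if_false, *] <;> grind

theorem eps_update_far {a c : ℕ} (hac : a + 1 < c ∨ c + 1 < a) {t : α → ℕ} {p : α}
    (hp : t p = c) (L : List α) : eps a (Function.update t p (c + 1)) L = eps a t L := by
  induction L with
  | nil => rfl
  | cons b L ih =>
    by_cases h : b = p
    · subst h
      simp only [eps, ih, Function.update_self, letterPhi, letterEps]
      grind
    · simp only [eps, ih, Function.update_of_ne h]

/-- The two-coloured recording word is invariant under `f̃_a` and `f̃_c`. -/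
theorem record₂_update {a c d : ℕ} (hac : a + 1 < c) (hd : d = a ∨ d = c) {t : α → ℕ}
    {L : List α} {p : α} (hL : L.Nodup) (h : fPos d t L = some p) :
    record₂ a c (Function.update t p (d + 1)) L = record₂ a c t L := by
  induction L with
  | nil => rfl
  | cons b L ih =>
    rw [List.nodup_cons] at hL
    have hpd := (fPos_spec h).1
    have ea : d = c → eps a (Function.update t p (d + 1)) L = eps a t L := fun hdc =>
      eps_update_far (by omega) hpd L
    have ec : d = a → eps c (Function.update t p (d + 1)) L = eps c t L := fun hda =>
      eps_update_far (by omega) hpd L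
    simp only [fPos] at h
    split_ifs at h with h1
    · obtain rfl : b = p := by simpa using h
      have ht : ∀ x ∈ L, Function.update t b (d + 1) x = t x := fun x hx =>
        Function.update_of_ne (by rintro rfl; exact hL.1 hx) _ _
      simp only [record₂, record₂_congr ht, eps_congr ht, Function.update_self]
      unfold letterPhi at h1
      congr 1
      grind
    · have hi := ih hL.2 h
      have hp := mem_of_fPos h
      have he := (fPos_update hL.2 h).1
      have hbp : b ≠ p := by rintro rfl; exact hL.1 hp
      simp only [record₂, hi, Function.update_of_ne hbp]
      unfold letterPhi at h1
      congr 1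
      grind

end WordCrystal

/-! ### Weyl group relations for the crystal reflections -/

namespace SST

open WordCrystal YoungDiagram

variable {n : ℕ} {μ : YoungDiagram}

theorem content_eq_mult (T : SST n μ) (k : ℕ) : T.content k = mult k T.entry μ.readingBoxes :=
  T.content_eq_countP k

theorem exists_of_crystalF {i : Fin (n - 1)} {T U : SST n μ} (h : crystalF i T = some U) :
    ∃ b, fPos (i + 1) T.entry μ.readingBoxes = some b ∧
      U.entry = Function.update T.entry b (i + 2) := by
  simp only [crystalF, Option.pmap_eq_some_iff] at h
  obtain ⟨b, hset, hb, rfl⟩ := h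
  exact ⟨b, hb, rfl⟩

theorem partialPow_invariant {X β : Type*} {g : X → Option X} {R : X → β}
    (h : ∀ x y, g x = some y → R y = R x) {k : ℕ} {x y : X} (hk : partialPow g k x = some y) :
    R y = R x := by
  induction k generalizing x with
  | zero =>
    obtain rfl : x = y := by simpa [partialPow] using hk
    rfl
  | succ k ih =>
    simp only [partialPow, Option.bind_eq_some_iff] at hk
    obtain ⟨z, hz, hk⟩ := hk
    exact (ih hk).trans (h _ _ hz)

/-- A function that is constant along the arrows of colour `i` is invariant under `s̃_i`. -/
theorem reflection_invariant {β : Type*} {R : SST n μ → β} {i : Fin (n - 1)}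
    (h : ∀ T U, crystalF i T = some U → R U = R T) (T : SST n μ) :
    R (reflection n μ i T) = R T := by
  change R (reflectionFun i T) = R T
  unfold reflectionFun
  split_ifs
  · exact partialPow_invariant h (Option.some_get _).symm
  · exact partialPow_invariant (fun x y hxy => (h _ _ (crystalE_eq_some hxy).1).symm)
      (Option.some_get _).symm

theorem pairing_reflection (i : Fin (n - 1)) (T : SST n μ) :
    (reflection n μ i T).pairing i = -T.pairing i := by
  change (reflectionFun i T).pairing i = _
  have hT := T.phi_sub_eps_eq i
  by_cases h : 0 ≤ T.pairing i
  · obtain ⟨U, hU, -, hp⟩ := T.partialPow_crystalF i (T.pairing i).toNat (by omega)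
    have e : reflectionFun i T = U := by
      rw [reflectionFun, if_pos h]
      simp [hU]
    rw [e]
    omega
  · obtain ⟨U, hU, -, hp⟩ := T.partialPow_crystalE i (-T.pairing i).toNat (by omega)
    have e : reflectionFun i T = U := by
      rw [reflectionFun, if_neg h]
      simp [hU]
    rw [e]
    omega

theorem content_crystalF {i : Fin (n - 1)} {T U : SST n μ} (h : crystalF i T = some U) (k : ℕ) :
    U.content k + (if k = i + 1 then 1 else 0) = T.content k + if k = i + 2 then 1 else 0 := by
  obtain ⟨b, hb, hU⟩ := exists_of_crystalF h
  have := mult_update (t := T.entry) (nodup_readingBoxes μ) (mem_of_fPos hb) k (i + 2)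
  rw [(fPos_spec hb).1] at this
  rw [content_eq_mult, content_eq_mult, hU]
  simpa only [eq_comm] using this

theorem content_reflection_of_ne (i : Fin (n - 1)) (T : SST n μ) {k : ℕ} (h₁ : k ≠ i + 1)
    (h₂ : k ≠ i + 2) : (reflection n μ i T).content k = T.content k :=
  reflection_invariant (R := fun T => T.content k) (fun T U h => by
    have := content_crystalF h k
    rwa [if_neg h₁, if_neg h₂] at this) T

theorem content_add_reflection (i : Fin (n - 1)) (T : SST n μ) :
    (reflection n μ i T).content (i + 1) + (reflection n μ i T).content (i + 2) =
      T.content (i + 1) + T.content (i + 2) :=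
  reflection_invariant (R := fun T => T.content (i + 1) + T.content (i + 2)) (fun T U h => by
    have h1 := content_crystalF h (i + 1)
    have h2 := content_crystalF h (i + 2)
    simp at h1 h2
    omega) T

theorem content_reflection_left (i : Fin (n - 1)) (T : SST n μ) :
    (reflection n μ i T).content (i + 1) = T.content (i + 2) := by
  have h1 := content_add_reflection i T
  have h2 := pairing_reflection i T
  unfold pairing at h2
  omega

theorem content_reflection_right (i : Fin (n - 1)) (T : SST n μ) :
    (reflection n μ i T).content (i + 2) = T.content (i + 1) := by
  have h1 := content_add_reflection i T
  have h2 := content_reflection_left i T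
  omega

/-- `s̃_i` exchanges `ε_i` and `φ_i`; here `φ_i` is written as `ε_i + c_i - c_{i+1}`. -/
theorem crystalEps_reflection (i : Fin (n - 1)) (T : SST n μ) :
    (reflection n μ i T).crystalEps i + T.content (i + 2) =
      T.crystalEps i + T.content (i + 1) := by
  have h1 : 2 * ((reflection n μ i T).crystalEps i : ℤ) + (reflection n μ i T).pairing i =
      2 * (T.crystalEps i : ℤ) + T.pairing i :=
    reflection_invariant (R := fun T => 2 * (T.crystalEps i : ℤ) + T.pairing i) (fun T U h => by
      obtain ⟨-, h1, h2⟩ := crystalF_eq_some h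
      rw [h1, h2]
      push_cast
      ring) T
  rw [pairing_reflection] at h1
  unfold pairing at h1
  omega

theorem crystalEps_reflection_of_far {i j : Fin (n - 1)} (h : (i : ℕ) + 1 < j ∨ (j : ℕ) + 1 < i)
    (T : SST n μ) : (reflection n μ j T).crystalEps i = T.crystalEps i :=
  reflection_invariant (fun T U hU => by
    obtain ⟨b, hb, hU⟩ := exists_of_crystalF hU
    rw [crystalEps, crystalEps, hU]
    exact eps_update_far (by omega) (fPos_spec hb).1 _) T

theorem eq_of_entry {T U : SST n μ} (h : ∀ b ∈ μ.readingBoxes, T.entry b = U.entry b) : T = U := by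
  apply entry_injective
  funext b
  by_cases hb : b ∈ μ
  · exact h b (mem_readingBoxes.2 hb)
  · exact (T.1.zeros hb).trans (U.1.zeros hb).symm

theorem record₂_reflection {i j k : Fin (n - 1)} (hij : (i : ℕ) + 1 < j) (hk : k = i ∨ k = j)
    (T : SST n μ) :
    record₂ (i + 1) (j + 1) (reflection n μ k T).entry μ.readingBoxes =
      record₂ (i + 1) (j + 1) T.entry μ.readingBoxes :=
  reflection_invariant (R := fun T => record₂ (i + 1) (j + 1) T.entry μ.readingBoxes)
    (fun T U hU => by
      obtain ⟨b, hb, hU⟩ := exists_of_crystalF hU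
      simp only [hU]
      exact record₂_update (by omega) (by rcases hk with rfl | rfl <;> simp)
        (nodup_readingBoxes μ) hb) T

/-- Both sides have the same two-coloured recording word and the same `ε_i` and `ε_j`. -/
theorem reflection_comm {i j : Fin (n - 1)} (hij : (i : ℕ) + 1 < j) :
    reflection n μ i * reflection n μ j = reflection n μ j * reflection n μ i := by
  ext T : 1
  simp only [Equiv.Perm.mul_apply]
  refine eq_of_entry (record₂_inj (a := i + 1) (c := j + 1) (by omega) ?_ ?_ ?_)
  · rw [record₂_reflection hij (by simp), record₂_reflection hij (by simp),
      record₂_reflection hij (by simp), record₂_reflection hij (by simp)]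
  · change crystalEps i _ = crystalEps i _
    have h1 := crystalEps_reflection i (reflection n μ j T)
    have h2 := crystalEps_reflection i T
    have h3 := crystalEps_reflection_of_far (Or.inl hij) T
    have h4 := crystalEps_reflection_of_far (Or.inl hij) (reflection n μ i T)
    have h5 := content_reflection_of_ne j T (k := i + 1) (by omega) (by omega)
    have h6 := content_reflection_of_ne j T (k := i + 2) (by omega) (by omega)
    omega
  · change crystalEps j _ = crystalEps j _
    have h1 := crystalEps_reflection j (reflection n μ i T)
    have h2 := crystalEps_reflection j T
    have h3 := crystalEps_reflection_of_far (Or.inr hij) T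
    have h4 := crystalEps_reflection_of_far (Or.inr hij) (reflection n μ j T)
    have h5 := content_reflection_of_ne i T (k := j + 1) (by omega) (by omega)
    have h6 := content_reflection_of_ne i T (k := j + 2) (by omega) (by omega)
    omega

theorem record_reflection {i j : Fin (n - 1)} (h : j = i ∨ (j : ℕ) = i + 1) (T : SST n μ) :
    record (i + 1) (reflection n μ j T).entry μ.readingBoxes =
      record (i + 1) T.entry μ.readingBoxes :=
  reflection_invariant (R := fun T => record (i + 1) T.entry μ.readingBoxes) (fun T U hU => by
    obtain ⟨b, hb, hU⟩ := exists_of_crystalF hU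
    simp only [hU]
    rcases h with rfl | h
    · exact record_update_left (nodup_readingBoxes μ) hb
    · rw [h] at hb ⊢
      exact record_update_right (nodup_readingBoxes μ) hb) T

theorem isPattern_entry {i j : Fin (n - 1)} (h : (j : ℕ) = i + 1) (T : SST n μ) :
    IsPattern (T.content (i + 1)) (T.content (i + 2)) (T.content (j + 2)) (T.crystalEps i)
      (T.crystalEps j) ((record (i + 1) T.entry μ.readingBoxes).count 0)
      ((record (i + 1) T.entry μ.readingBoxes).count 1)
      ((record (i + 1) T.entry μ.readingBoxes).count 2) := by
  simp only [content_eq_mult, crystalEps, h]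
  exact isPattern _ _ _

/-- Both sides have the same recording word and the same content, so by `record_inj` it remains
to compare `ε_i`, which is a piecewise linear identity on Gelfand–Tsetlin patterns. -/
theorem reflection_braid {i j : Fin (n - 1)} (h : (j : ℕ) = i + 1) :
    reflection n μ i * reflection n μ j * reflection n μ i =
      reflection n μ j * reflection n μ i * reflection n μ j := by
  have hj : (j : ℕ) + 1 = i + 2 := by omega
  have l1 (T : SST n μ) := content_reflection_left i T
  have l2 (T : SST n μ) := content_reflection_right i T
  have l3 (T : SST n μ) : (reflection n μ i T).content (j + 2) = T.content (j + 2) :=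
    content_reflection_of_ne i T (by omega) (by omega)
  have r1 (T : SST n μ) : (reflection n μ j T).content (i + 1) = T.content (i + 1) :=
    content_reflection_of_ne j T (by omega) (by omega)
  have r2 (T : SST n μ) : (reflection n μ j T).content (i + 2) = T.content (j + 2) := by
    rw [← hj]; exact content_reflection_left j T
  have r3 (T : SST n μ) : (reflection n μ j T).content (j + 2) = T.content (i + 2) := by
    rw [← hj]; exact content_reflection_right j T
  have el (T : SST n μ) := crystalEps_reflection i T
  have er (T : SST n μ) : (reflection n μ j T).crystalEps j + T.content (j + 2) =
      T.crystalEps j + T.content (i + 2) := by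
    rw [← hj]; exact crystalEps_reflection j T
  have ul (T : SST n μ) := record_reflection (i := i) (j := i) (Or.inl rfl) T
  have ur (T : SST n μ) := record_reflection (i := i) (j := j) (Or.inr h) T
  have hP (T : SST n μ) := isPattern_entry h T
  ext T : 1
  simp only [Equiv.Perm.mul_apply]
  refine eq_of_entry (record_inj (a := i + 1) ?_ ?_ ?_ ?_)
  · simp only [ul, ur]
  · rw [← content_eq_mult, ← content_eq_mult]
    simp only [l1, l3, r1, r2]
  · rw [← content_eq_mult, ← content_eq_mult]
    change content _ (i + 2) = content _ (i + 2)
    simp only [l1, l2, l3, r1, r2, r3]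
  · change crystalEps i _ = crystalEps i _
    obtain ⟨-, a1, b1, c1, d1, f1, g1⟩ := hP T
    obtain ⟨-, a2, b2, c2, d2, f2, g2⟩ := hP (reflection n μ i T)
    obtain ⟨-, a3, b3, c3, d3, f3, g3⟩ := hP (reflection n μ j (reflection n μ i T))
    obtain ⟨-, a4, b4, c4, d4, f4, g4⟩ := hP (reflection n μ j T)
    obtain ⟨-, a5, b5, c5, d5, f5, g5⟩ := hP (reflection n μ i (reflection n μ j T))
    obtain ⟨-, a6, b6, c6, d6, f6, g6⟩ :=
      hP (reflection n μ j (reflection n μ i (reflection n μ j T)))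
    -- The top rows agree along both chains, `s̃_i` exchanges `ε_i` with `φ_i`, and `s̃_j` exchanges
    -- `ε_j` with `φ_j`; the formula for `ε_j` then fixes `ε_i` after each application of `s̃_j`.
    have e1 := el T
    have e2 := er (reflection n μ i T)
    have e3 := el (reflection n μ j (reflection n μ i T))
    have e4 := er T
    have e5 := el (reflection n μ j T)
    have e6 := er (reflection n μ i (reflection n μ j T))
    simp only [ul, ur, l1, l2, l3, r1, r2, r3] at *
    omega

end SST

/-! ### The order of a Coxeter element of type `A` -/

section CoxeterRelations

variable {G : Type*} [Group G]

/-- The product `x 0 * x 1 * ⋯ * x (m - 1)`. -/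
def prodRange (x : ℕ → G) : ℕ → G
  | 0 => 1
  | m + 1 => prodRange x m * x m

theorem prodRange_eq_prod_ofFn (m : ℕ) (x : ℕ → G) :
    prodRange x m = (List.ofFn fun i : Fin m => x i).prod := by
  induction m with
  | zero => simp [prodRange]
  | succ m ih => rw [prodRange, ih, List.ofFn_succ_last, List.prod_append, List.prod_singleton]; rfl

theorem prodRange_commute {x : ℕ → G} (hcomm : ∀ i j, i + 1 < j → x i * x j = x j * x i)
    {m k : ℕ} (h : m < k) : prodRange x m * x k = x k * prodRange x m := by
  induction m with
  | zero => simp [prodRange]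
  | succ m ih =>
    rw [prodRange, mul_assoc, hcomm m k h, ← mul_assoc, ih (by omega), mul_assoc]

/-- Conjugation by the Coxeter element shifts the generators. -/
theorem prodRange_mul {x : ℕ → G} (hcomm : ∀ i j, i + 1 < j → x i * x j = x j * x i) {m : ℕ}
    (hbraid : ∀ i, i + 1 < m → x i * x (i + 1) * x i = x (i + 1) * x i * x (i + 1)) {i : ℕ}
    (hi : i + 1 < m) : prodRange x m * x i = x (i + 1) * prodRange x m := by
  induction m with
  | zero => omega
  | succ m ih =>
    rcases Nat.lt_or_ge (i + 1) m with h | h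
    · rw [prodRange, mul_assoc, ← hcomm i m h, ← mul_assoc,
        ih (fun k hk => hbraid k (by omega)) h, mul_assoc]
    · obtain rfl : m = i + 1 := by omega
      have hc := prodRange_commute hcomm (Nat.lt_succ_self i)
      simp only [prodRange, Nat.succ_eq_add_one] at hc ⊢
      calc prodRange x i * x i * x (i + 1) * x i
          = prodRange x i * (x i * x (i + 1) * x i) := by group
        _ = prodRange x i * x (i + 1) * (x i * x (i + 1)) := by rw [hbraid i (by omega)]; group
        _ = x (i + 1) * (prodRange x i * x i * x (i + 1)) := by rw [hc]; group

/-- The product `x (m - 1) * ⋯ * x 1 * x 0`. -/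
def revProdRange (x : ℕ → G) : ℕ → G
  | 0 => 1
  | m + 1 => x m * revProdRange x m

theorem revProdRange_mul_prodRange {x : ℕ → G} {m : ℕ} (hinv : ∀ i, x i * x i = 1) :
    revProdRange x m * prodRange x m = 1 := by
  induction m with
  | zero => simp [prodRange, revProdRange]
  | succ m ih =>
    rw [revProdRange, prodRange]
    calc x m * revProdRange x m * (prodRange x m * x m)
        = x m * (revProdRange x m * prodRange x m) * x m := by group
      _ = 1 := by rw [ih, mul_one, hinv]

theorem mul_prodRange_mul_prodRange {x : ℕ → G}
    (hcomm : ∀ i j, i + 1 < j → x i * x j = x j * x i) {m : ℕ}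
    (hbraid : ∀ i, i + 1 < m → x i * x (i + 1) * x i = x (i + 1) * x i * x (i + 1)) {j : ℕ}
    (hj : j < m) : x 0 * prodRange x m * prodRange x j = prodRange x (j + 1) * prodRange x m := by
  induction j with
  | zero => simp [prodRange]
  | succ j ih =>
    rw [prodRange, ← mul_assoc, ih (by omega), prodRange, mul_assoc,
      prodRange_mul hcomm hbraid hj, ← mul_assoc]
    rfl

theorem prodRange_mul_revProdRange {x : ℕ → G}
    (hcomm : ∀ i j, i + 1 < j → x i * x j = x j * x i) (hinv : ∀ i, x i * x i = 1) {m : ℕ}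
    (hbraid : ∀ i, i + 1 < m → x i * x (i + 1) * x i = x (i + 1) * x i * x (i + 1)) {j : ℕ}
    (hj : j < m) :
    prodRange x m * revProdRange x j = revProdRange x (j + 1) * x 0 * prodRange x m := by
  induction j with
  | zero => simp [revProdRange, hinv]
  | succ j ih =>
    rw [revProdRange, ← mul_assoc, prodRange_mul hcomm hbraid hj, mul_assoc, ih (by omega),
      revProdRange.eq_2 x (j + 1)]
    group

/-- A Coxeter element of type `A_m` has order dividing `m + 1`. -/
theorem prodRange_pow_add_one {x : ℕ → G}
    (hcomm : ∀ i j, i + 1 < j → x i * x j = x j * x i) (hinv : ∀ i, x i * x i = 1) {m : ℕ}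
    (hbraid : ∀ i, i + 1 < m → x i * x (i + 1) * x i = x (i + 1) * x i * x (i + 1)) :
    prodRange x m ^ (m + 1) = 1 := by
  induction m with
  | zero => simp [prodRange]
  | succ m ih =>
    -- With `c_m = x 0 ⋯ x (m - 1)`, this is `c_{m+1}^{j+1} = (x (j - 1) ⋯ x 0) c_{m+1} c_m^j`. For
    -- `j = m + 1` the first two factors cancel, which reduces the claim to `c_m^{m+1} = 1`.
    have key : ∀ j ≤ m + 1, prodRange x (m + 1) ^ (j + 1) =
        revProdRange x j * prodRange x (m + 1) * prodRange x m ^ j := by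
      intro j hj
      induction j with
      | zero => simp [revProdRange]
      | succ j ihj =>
        have h₁ := prodRange_mul_revProdRange hcomm hinv hbraid (j := j) (by omega)
        have h₂ := mul_prodRange_mul_prodRange hcomm hbraid (Nat.lt_succ_self m)
        calc prodRange x (m + 1) ^ (j + 1 + 1)
            = prodRange x (m + 1) * revProdRange x j * prodRange x (m + 1) *
                prodRange x m ^ j := by
              rw [pow_succ', ihj (by omega)]
              group
          _ = revProdRange x (j + 1) * x 0 * (prodRange x (m + 1) * prodRange x (m + 1)) *
                prodRange x m ^ j := by
              rw [h₁]
              group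
          _ = revProdRange x (j + 1) * (x 0 * x 0) * prodRange x (m + 1) *
                (prodRange x m * prodRange x m ^ j) := by
              rw [← h₂]
              group
          _ = _ := by rw [hinv, mul_one, ← pow_succ']
    rw [key (m + 1) le_rfl, revProdRange_mul_prodRange hinv, one_mul,
      ih fun i hi => hbraid i (by omega)]

end CoxeterRelations

/-! ### The action of the Coxeter element on contents, and cyclic sieving -/

namespace SST

variable {n : ℕ} {μ : YoungDiagram}

/-- The bijections `s̃_1, s̃_2, …` as a sequence indexed by all natural numbers from `0`, extended
by the identity. -/
def simpleReflection (n : ℕ) (μ : YoungDiagram) (i : ℕ) : Equiv.Perm (SST n μ) :=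
  if h : i < n - 1 then reflection n μ ⟨i, h⟩ else 1

theorem coxeter_eq_prodRange (n : ℕ) (μ : YoungDiagram) :
    coxeter n μ = prodRange (simpleReflection n μ) (n - 1) := by
  rw [prodRange_eq_prod_ofFn, coxeter]
  congr 2
  funext i
  simp [simpleReflection]

theorem coxeter_pow (hn : 0 < n) : coxeter n μ ^ n = 1 := by
  rw [coxeter_eq_prodRange]
  suffices h : prodRange (simpleReflection n μ) (n - 1) ^ (n - 1 + 1) = 1 by
    rwa [Nat.sub_add_cancel hn] at h
  refine prodRange_pow_add_one ?_ ?_ ?_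
  · intro i j hij
    unfold simpleReflection
    by_cases hj : j < n - 1
    · rw [dif_pos hj, dif_pos (by omega)]
      exact reflection_comm hij
    · rw [dif_neg hj, one_mul, mul_one]
  · intro i
    unfold simpleReflection
    split_ifs
    · ext T : 1
      exact reflectionFun_involutive _ T
    · simp
  · intro i hi
    unfold simpleReflection
    rw [dif_pos (by omega), dif_pos (by omega)]
    exact reflection_braid rfl

/-- `s̃_1 ⋯ s̃_m` permutes the content by a cycle of length `m + 1`. -/
theorem content_prodRange (T : SST n μ) {m : ℕ} (hm : m < n) :
    (prodRange (simpleReflection n μ) m T).content 1 = T.content (m + 1) ∧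
      (∀ k < m, (prodRange (simpleReflection n μ) m T).content (k + 2) = T.content (k + 1)) ∧
      ∀ k > m, (prodRange (simpleReflection n μ) m T).content (k + 1) = T.content (k + 1) := by
  induction m generalizing T with
  | zero => simp [prodRange]
  | succ m ih =>
    obtain ⟨h1, h2, h3⟩ := ih (simpleReflection n μ m T) (by omega)
    rw [prodRange, Equiv.Perm.mul_apply]
    have hx : simpleReflection n μ m = reflection n μ ⟨m, by omega⟩ := dif_pos _
    have hl := content_reflection_left ⟨m, by omega⟩ T
    have hr := content_reflection_right ⟨m, by omega⟩ T
    rw [← hx] at hl hr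
    refine ⟨h1.trans hl, fun k hk => ?_, fun k hk => ?_⟩
    · rcases Nat.lt_succ_iff_lt_or_eq.1 hk with hk | rfl
      · rw [h2 k hk, hx, content_reflection_of_ne _ _ (by simp; omega) (by simp; omega)]
      · exact (h3 (k + 1) (by omega)).trans hr
    · rw [h3 k (by omega), hx, content_reflection_of_ne _ _ (by simp; omega) (by simp; omega)]

/-- The exponent `∑ (k - 1) c_k` of `q` in the monomial of a tableau at `x_k = q^{k-1}`. -/
def charge (T : SST n μ) : ℕ := ∑ k : Fin n, (k : ℕ) * T.content (k + 1)

theorem entry_bounds (T : SST n μ) {b : ℕ × ℕ} (hb : b ∈ μ) :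
    1 ≤ T.entry b ∧ T.entry b ≤ n := T.2 b.1 b.2 hb

theorem sum_mul_content (T : SST n μ) (g : ℕ → ℕ) :
    ∑ k : Fin n, g k * T.content (k + 1) = ∑ b ∈ μ.cells, g (T.entry b - 1) := by
  rw [← Finset.sum_range fun k => g k * T.content (k + 1),
    ← Finset.sum_fiberwise_of_maps_to (t := Finset.range n) (g := fun b => T.entry b - 1)]
  · refine Finset.sum_congr rfl fun k _ => ?_
    rw [Finset.sum_congr rfl (g := fun _ => g k) fun b hb => by rw [(Finset.mem_filter.1 hb).2],
      Finset.sum_const, smul_eq_mul, mul_comm, content]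
    congr 2
    refine Finset.filter_congr fun b hb => ?_
    have := T.entry_bounds ((YoungDiagram.mem_cells _).1 hb)
    omega
  · intro b hb
    have := T.entry_bounds ((YoungDiagram.mem_cells _).1 hb)
    rw [Finset.mem_range]
    omega

theorem sum_content (T : SST n μ) : ∑ k : Fin n, T.content (k + 1) = μ.card := by
  simpa using T.sum_mul_content fun _ => 1

theorem charge_eq (T : SST n μ) : T.charge = ∑ b ∈ μ.cells, (T.entry b - 1) :=
  T.sum_mul_content fun k => k

/-- The Coxeter element raises `charge` by `|μ|` modulo `n`. -/
theorem charge_coxeter (hn : 0 < n) (T : SST n μ) :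
    (coxeter n μ T).charge + n * T.content n = T.charge + μ.card := by
  obtain ⟨m, rfl⟩ : ∃ m, n = m + 1 := ⟨n - 1, by omega⟩
  obtain ⟨-, h, -⟩ := content_prodRange T (Nat.lt_succ_self m)
  rw [← sum_content T, charge, charge, Fin.sum_univ_succ, Fin.sum_univ_castSucc,
    Fin.sum_univ_castSucc, coxeter_eq_prodRange]
  simp only [Fin.val_zero, zero_mul, zero_add, Fin.val_succ, Fin.val_castSucc, Fin.val_last,
    Nat.add_sub_cancel]
  rw [Finset.sum_congr rfl fun (k : Fin m) _ => by rw [h k k.2]]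
  simp only [add_mul, one_mul, Finset.sum_add_distrib]
  ring

theorem charge_coxeter_pow (hn : 0 < n) (T : SST n μ) (k : ℕ) :
    (((coxeter n μ ^ k) T).charge : ZMod n) = T.charge + k * μ.card := by
  induction k with
  | zero => simp
  | succ k ih =>
    have h := congrArg (Nat.cast (R := ZMod n)) (charge_coxeter hn ((coxeter n μ ^ k) T))
    rw [Nat.cast_add, Nat.cast_add, Nat.cast_mul, ih, ZMod.natCast_self, zero_mul, add_zero] at h
    rw [pow_succ', Equiv.Perm.mul_apply, h]
    push_cast
    ring

theorem dvd_of_coxeter_pow_apply (hn : 0 < n) (hcop : Nat.gcd n μ.card = 1) {T : SST n μ} {k : ℕ}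
    (h : (coxeter n μ ^ k) T = T) : n ∣ k := by
  have h1 := charge_coxeter_pow hn T k
  rw [h, left_eq_add] at h1
  have h2 : ((k * μ.card : ℕ) : ZMod n) = 0 := by exact_mod_cast h1
  exact Nat.Coprime.dvd_of_dvd_mul_right hcop ((ZMod.natCast_eq_zero_iff _ _).1 h2)

/-- The highest weight tableau has every entry of row `i` equal to `i`. -/
theorem exists_tableau (hlen : μ.length < n) : Nonempty (SST n μ) := by
  refine ⟨⟨⟨fun i j => if (i, j) ∈ μ then i + 1 else 0, ?_, ?_, ?_⟩, ?_⟩⟩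
  · intro i j k hjk hk
    rw [if_pos hk, if_pos (μ.up_left_mem le_rfl hjk.le hk)]
  · intro i k j hik hk
    rw [if_pos hk, if_pos (μ.up_left_mem hik.le le_rfl hk)]
    omega
  · intro i j h
    exact if_neg h
  · intro i j h
    change 1 ≤ (if (i, j) ∈ μ then i + 1 else 0) ∧ (if (i, j) ∈ μ then i + 1 else 0) ≤ n
    rw [if_pos h]
    have : i < μ.length := by
      rw [YoungDiagram.length, YoungDiagram.length_rowLens, ← YoungDiagram.mem_iff_lt_colLen]
      exact μ.up_left_mem le_rfl (Nat.zero_le j) h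
    omega

theorem succ_le_entry (T : SST n μ) {i j : ℕ} (h : (i, j) ∈ μ) : i + 1 ≤ T.entry (i, j) := by
  induction i with
  | zero => exact (T.entry_bounds h).1
  | succ i ih =>
    have h1 := ih (μ.up_left_mem (Nat.le_succ i) le_rfl h)
    have h2 : T.entry (i, j) < T.entry (i + 1, j) := T.entry_col (Nat.lt_succ_self i) h
    omega

theorem kappa_eq : μ.kappa = ∑ b ∈ μ.cells, b.1 := by
  rw [YoungDiagram.kappa, ← Finset.sum_fiberwise_of_maps_to (t := Finset.range μ.length)
    (g := Prod.fst)]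
  · refine Finset.sum_congr rfl fun i _ => ?_
    rw [Finset.sum_congr rfl (g := fun _ => i) fun b hb => (Finset.mem_filter.1 hb).2,
      Finset.sum_const, smul_eq_mul, mul_comm, YoungDiagram.rowLen_eq_card]
    rfl
  · rintro ⟨i, j⟩ h
    rw [Finset.mem_range, YoungDiagram.length, YoungDiagram.length_rowLens,
      ← YoungDiagram.mem_iff_lt_colLen]
    exact μ.up_left_mem le_rfl (Nat.zero_le j) ((YoungDiagram.mem_cells _).1 h)

theorem kappa_le_charge (T : SST n μ) : μ.kappa ≤ T.charge := by
  rw [kappa_eq, charge_eq]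
  refine Finset.sum_le_sum fun b hb => ?_
  have : b.1 + 1 ≤ T.entry b := T.succ_le_entry ((YoungDiagram.mem_cells _).1 hb)
  omega

theorem schurPrincipal_eq : schurPrincipal n μ = ∑ T : SST n μ, Polynomial.X ^ T.charge := by
  rw [schurPrincipal, schurPoly, map_sum]
  refine Finset.sum_congr rfl fun T _ => ?_
  simp only [map_prod, map_pow, MvPolynomial.aeval_X, ← pow_mul, Finset.prod_pow_eq_pow_sum,
    charge]

theorem orderOf_coxeter (hlen : μ.length < n) (hcop : Nat.gcd n μ.card = 1) :
    orderOf (coxeter n μ) = n := by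
  have hn : 0 < n := by omega
  obtain ⟨T⟩ := exists_tableau hlen
  refine Nat.dvd_antisymm (orderOf_dvd_of_pow_eq_one (coxeter_pow hn))
    (dvd_of_coxeter_pow_apply hn hcop (T := T) ?_)
  rw [pow_orderOf_eq_one, Equiv.Perm.one_apply]

theorem eq_one_of_apply_eq (hlen : μ.length < n) (hcop : Nat.gcd n μ.card = 1)
    {g : Equiv.Perm (SST n μ)} (hg : g ∈ Subgroup.zpowers (coxeter n μ)) {T : SST n μ}
    (h : g T = T) : g = 1 := by
  obtain ⟨k, rfl⟩ := mem_powers_iff_mem_zpowers.2 hg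
  obtain ⟨m, rfl⟩ := dvd_of_coxeter_pow_apply (by omega) hcop h
  simp [pow_mul, coxeter_pow (show 0 < n by omega)]

/-- The Coxeter element permutes the summands up to the factor `ω ^ |μ| ≠ 1`. -/
theorem sum_pow_charge_eq_zero (hn : 0 < n) {ω : ℂ} (h1 : ω ^ n = 1) (h2 : ω ^ μ.card ≠ 1) :
    ∑ T : SST n μ, ω ^ T.charge = 0 := by
  have h : ∑ T : SST n μ, ω ^ T.charge = ω ^ μ.card * ∑ T : SST n μ, ω ^ T.charge := by
    refine (Equiv.sum_comp (coxeter n μ) fun T => ω ^ T.charge).symm.trans ?_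
    rw [Finset.mul_sum]
    refine Finset.sum_congr rfl fun T _ => ?_
    rw [← pow_add, add_comm, ← charge_coxeter hn T, pow_add, pow_mul, h1, one_pow, mul_one]
  by_contra h0
  exact h2 (mul_right_cancel₀ h0 (by rw [← h, one_mul]))

end SST

theorem theorem3p3 (n : ℕ) (μ : YoungDiagram) (hlen : μ.length < n)
    (hcop : Nat.gcd n μ.card = 1) :
    Nat.card (Subgroup.zpowers (SST.coxeter n μ)) = n ∧
    (∀ T : SST n μ, MulAction.stabilizer (Subgroup.zpowers (SST.coxeter n μ)) T = ⊥) ∧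
    ∃ f : Polynomial ℕ,
      Polynomial.X ^ μ.kappa * f = schurPrincipal n μ ∧
      CyclicSieving (SST n μ) (Subgroup.zpowers (SST.coxeter n μ)) f := by
  have hn : 0 < n := by omega
  refine ⟨?_, fun T => ?_, ∑ T : SST n μ, Polynomial.X ^ (T.charge - μ.kappa), ?_, ?_⟩
  · rw [Nat.card_zpowers, SST.orderOf_coxeter hlen hcop]
  · rw [eq_bot_iff]
    rintro ⟨g, hg⟩ hT
    exact Subtype.ext (SST.eq_one_of_apply_eq hlen hcop hg hT)
  · rw [SST.schurPrincipal_eq, Finset.mul_sum]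
    refine Finset.sum_congr rfl fun T _ => ?_
    rw [← pow_add, Nat.add_sub_cancel' T.kappa_le_charge]
  · rintro ⟨g, hg⟩ ω hω
    rw [Subgroup.orderOf_mk] at hω
    simp only [map_sum, map_pow, Polynomial.aeval_X]
    by_cases h1 : g = 1
    · subst h1
      rw [orderOf_one, IsPrimitiveRoot.one_right_iff] at hω
      have : MulAction.fixedBy (SST n μ)
          (⟨1, hg⟩ : Subgroup.zpowers (SST.coxeter n μ)) = Set.univ :=
        Set.eq_univ_of_forall fun T => rfl
      rw [this, hω]
      simp
    · have : MulAction.fixedBy (SST n μ)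
          (⟨g, hg⟩ : Subgroup.zpowers (SST.coxeter n μ)) = ∅ :=
        Set.eq_empty_of_forall_notMem fun T hT => h1 (SST.eq_one_of_apply_eq hlen hcop hg hT)
      rw [this, Nat.card_of_isEmpty, Nat.cast_zero]
      have hd : orderOf g ∣ n :=
        (orderOf_dvd_of_mem_zpowers hg).trans (SST.orderOf_coxeter hlen hcop).dvd
      have hzero := SST.sum_pow_charge_eq_zero (μ := μ) hn ((hω.pow_eq_one_iff_dvd n).2 hd)
        fun h => h1 (orderOf_eq_one_iff.1 (Nat.eq_one_of_dvd_coprimes hcop hd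
          ((hω.pow_eq_one_iff_dvd _).1 h)))
      have hω0 : ω ≠ 0 := hω.ne_zero ((Nat.pos_of_dvd_of_pos hd hn).ne')
      have hmul : ω ^ μ.kappa * ∑ T : SST n μ, ω ^ (T.charge - μ.kappa) = 0 := by
        rw [← hzero, Finset.mul_sum]
        refine Finset.sum_congr rfl fun T _ => ?_
        rw [← pow_add, Nat.add_sub_cancel' T.kappa_le_charge]
      exact ((mul_eq_zero.1 hmul).resolve_left (pow_ne_zero _ hω0)).symm
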